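/- Let $a,T,D\in\mathbb{R}$ with $a^2+D^2\neq0$ and consider the planar linear system $$\dot x=Tx-y,\qquad \dot y=Dx-a .\tag{1}$$ **Left Poincaré half-map.** For $y_0\ge 0$ let $\Psi(t;y_0)=(\Psi_1,\Psi_2)(t;y_0)$ be the solution of (1) with $\Psi(0;y_0)=(0,y_0)$. If there is $\tau(y_0)>0$ with $\Psi_1(\tau(y_0);y_0)=0$ and $\Psi_1(t;y_0)<0$ for all $t\in(0,\tau(y_0))$, then $P(y_0):=\Psi_2(\tau(y_0);y_0)$ is the image of $y_0$ under the left Poincaré half-map $P$ related to the section $\{x=0\}$, and $\tau(y_0)$ is the left flight time. If $P(0)$ cannot be defined in this way, but for every $\varepsilon>0$ there are $y_0\in(0,\varepsilon)$ and $y_1\in(-\varepsilon,0)$ with $P(y_0)=y_1$, then one puts $P(0):=0$, with $\tau(0):=\frac{2\pi}{\sqrt{4D-T^2}}$ if the origin is an equilibrium of (1) and $\tau(0):=0$ otherwise. **The index-like function.** Let $$V(x,y)=D^2x^2-DTxy+Dy^2+a(T^2-2D)x-aTy+a^2 .$$ Let $\mathcal C$ be the connected component of $\mathbb{R}^2\setminus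 V^{-1}(\{0\})$ that contains two points $(0,\xi_1)$, $(0,\xi_2)$ with $\xi_1\xi_2<0$ (and $\mathcal C=\emptyset$ if there is none), and let $$\mathcal I=\{y\in\mathbb{R}:\ (0,y)\in\operatorname{int}(\mathcal C\cup\{(0,0)\})\}.$$ For $y_1\le 0\le y_0$ in $\mathcal I$ let $$\mathcal F(y_1,y_0)=\operatorname{PV}\int_{y_1}^{y_0}\frac{-y}{V(0,y)}\,dy ,$$ an ordinary integral if $a\ne0$. If $a=0$ and $y_1<0<y_0$ it is the Cauchy principal value $\lim_{\varepsilon\searrow0}\big(\int_{y_1}^{-\varepsilon}+\int_{\varepsilon}^{y_0}\big)\frac{-y}{V(0,y)}\,dy$. If $a=0$ and exactly one of $y_0,y_1$ is $0$, then $\mathcal F(y_1,y_0)$ is undefined. If $a=0$ and $y_0=y_1=0$, then $\mathcal F(0,0)$ is understood to take every value, that is, every equation $\mathcal F(0,0)=q$ is taken to hold. **Theorem.** Assume that $\mathcal I\neq\emptyset$. Let $c\in\mathbb{R}$ and $y_0,y_1\in\mathcal I$ with $y_0\ge0\ge y_1$ be such that $$\mathcal F(y_1,y_0)=cT ,$$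 and assume that one of the following conditions holds: (i) $c=0$ and $a>0$; (ii) $4D-T^2>0$, $c=\dfrac{\pi}{D\sqrt{4D-T^2}}$ and $a=0$; (iii) $4D-T^2>0$, $c=\dfrac{2\pi}{D\sqrt{4D-T^2}}$ and $a<0$. Then $y_1=P(y_0)$, that is, $y_1$ is the image of $y_0$ under the left Poincaré half-map of (1), and the corresponding left flight time is $$\tau(y_0)=2Dc+\int_{y_1}^{y_0}\frac{a}{V(0,y)}\,dy ,$$ where the integral converges (for $a=0$ its integrand is identically $0$). -/

import Mathlib

open Filter Topology MeasureTheory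

namespace PoincareHalfMap

/-- The vector field `L(x, y) = (T x - y, D x - a)` of the planar linear system in Liénard form. -/
def vectorField (a T D : ℝ) (p : ℝ × ℝ) : ℝ × ℝ :=
  (T * p.1 - p.2, D * p.1 - a)

/-- `Ψ` is the orbit of the system that satisfies `Ψ(0) = (0, y₀)`. -/
def IsOrbitFrom (a T D y₀ : ℝ) (Ψ : ℝ → ℝ × ℝ) : Prop :=
  Ψ 0 = (0, y₀) ∧ ∀ t : ℝ, HasDerivAt Ψ (vectorField a T D (Ψ t)) t

/-- The orbit through `(0, y₀)`, `y₀ ≥ 0`, stays in `{x < 0}` on `(0, τ)`, `τ > 0`, and returns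
to `{x = 0}` at the time `τ`, at the point `(0, y₁)`. -/
def ReturnsLeft (a T D y₀ y₁ τ : ℝ) : Prop :=
  0 ≤ y₀ ∧ 0 < τ ∧ ∃ Ψ : ℝ → ℝ × ℝ, IsOrbitFrom a T D y₀ Ψ ∧
    Ψ τ = (0, y₁) ∧ ∀ t ∈ Set.Ioo 0 τ, (Ψ t).1 < 0

/-- The situation in which the left Poincaré half-map is extended by `P(0) = 0`: it cannot be
defined at `0` through a return of the orbit, but it maps points `y₀ > 0` arbitrarily close to `0`
to points `y₁ < 0` arbitrarily close to `0`. -/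
def ExtendsToOrigin (a T D : ℝ) : Prop :=
  (¬ ∃ y₁ τ : ℝ, ReturnsLeft a T D 0 y₁ τ) ∧
    ∀ ε > 0, ∃ y₀ ∈ Set.Ioo 0 ε, ∃ y₁ ∈ Set.Ioo (-ε) 0, ∃ τ : ℝ, ReturnsLeft a T D y₀ y₁ τ

open Classical in
/-- The flight time assigned to the origin when the half-map is extended by `P(0) = 0`:
`2π / √(4D - T²)` if the origin is an equilibrium, and `0` otherwise (invisible tangency). -/
noncomputable def originFlightTime (a T D : ℝ) : ℝ :=
  if vectorField a T D (0, 0) = (0, 0) then 2 * Real.pi / Real.sqrt (4 * D - T ^ 2) else 0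

/-- `y₁ = P(y₀)` for the left Poincaré half-map `P` of the system related to the section
`{x = 0}`, and the corresponding left flight time is `τ`. -/
def IsLeftHalfMapImage (a T D y₀ y₁ τ : ℝ) : Prop :=
  ReturnsLeft a T D y₀ y₁ τ ∨
    (y₀ = 0 ∧ y₁ = 0 ∧ ExtendsToOrigin a T D ∧ τ = originFlightTime a T D)

/-- The quadratic inverse integrating factor
`V(x, y) = D² x² - D T x y + D y² + a (T² - 2 D) x - a T y + a²`. -/
def V (a T D : ℝ) (p : ℝ × ℝ) : ℝ :=
  D ^ 2 * p.1 ^ 2 - D * T * p.1 * p.2 + D * p.2 ^ 2 + a * (T ^ 2 - 2 * D) * p.1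
    - a * T * p.2 + a ^ 2

/-- The connected component `𝒞` of `ℝ² \ V⁻¹(0)` that contains two points `(0, ξ₁)` and `(0, ξ₂)`
with `ξ₁ ξ₂ < 0`; it is empty if there is no such component. -/
def mainComponent (a T D : ℝ) : Set (ℝ × ℝ) :=
  {p | ∃ ξ₁ ξ₂ : ℝ, ξ₁ * ξ₂ < 0 ∧
    (0, ξ₁) ∈ connectedComponentIn {q | V a T D q ≠ 0} p ∧
    (0, ξ₂) ∈ connectedComponentIn {q | V a T D q ≠ 0} p}

/-- The open interval `𝓘`. -/
def mainInterval (a T D : ℝ) : Set ℝ :=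
  {y | ((0, y) : ℝ × ℝ) ∈ interior (mainComponent a T D ∪ {(0, 0)})}

/-- For `ξ₁ ≤ ξ₂`: the integral of `h` from `ξ₁` to `ξ₂` has the value `v`, either as a convergent
integral or, if `ξ₁ < 0 < ξ₂`, as a Cauchy principal value at the singularity `0`. -/
def HasPVIntegral (h : ℝ → ℝ) (ξ₁ ξ₂ v : ℝ) : Prop :=
  (IntervalIntegrable h volume ξ₁ ξ₂ ∧ ∫ y in ξ₁..ξ₂, h y = v) ∨
    (ξ₁ < 0 ∧ 0 < ξ₂ ∧
      (∀ᶠ ε in 𝓝[>] (0 : ℝ),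
        IntervalIntegrable h volume ξ₁ (-ε) ∧ IntervalIntegrable h volume ε ξ₂) ∧
      Tendsto (fun ε : ℝ => (∫ y in ξ₁..(-ε), h y) + ∫ y in ε..ξ₂, h y) (𝓝[>] 0) (𝓝 v))

/-- The equation `𝓕(y₁, y₀) = q` for the index-like function
`𝓕(y₁, y₀) = PV ∫_{y₁}^{y₀} -y / V(0, y) dy`, where `y₁ ≤ 0 ≤ y₀`. For `a = 0` the expression
`𝓕(0, 0)` is understood to take every value: the origin belongs to all level curves. -/
def IndexLikeEq (a T D y₁ y₀ q : ℝ) : Prop :=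
  HasPVIntegral (fun y => -y / V a T D (0, y)) y₁ y₀ q ∨ (a = 0 ∧ y₁ = 0 ∧ y₀ = 0)

end PoincareHalfMap

namespace PoincareHalfMap

/-! Along an orbit the pair `u = a - D x`, `v = T x - y = x'` obeys the linear system `u' = -D v`,
`v' = u + T v`. On the section it equals `(a, -y)`, and there `V` is the quadratic form `u² + T u v
+ D v²`. Where `V ≠ 0`, put `A = ∫ -y / V` and `B = ∫ a / V` over `[y₁, y₀]`: flowing `(a, -y₀)` for
the time `B` and scaling by `exp (D A)` gives `(a, -y₁)` (`exp_mul_flow_eq`,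
`exp_mul_complex_flow_eq`).

The equation `A = c T` disposes of the scaling. For `a > 0` it says `A = 0`, and the orbit itself
reaches `(0, y₁)` at time `B`. For `a < 0` the factor `exp (D A)` is the growth during one full turn
of the focus, so the arrival time is `2π/ω + B`. For `a = 0` the principal value is a difference of
logarithms, and the equation expresses the half-turn factor `-exp (π T / (2 ω))`.

It remains to exclude an earlier return. For `a > 0`, Rolle's theorem would give two zeros of `x'`,
impossible for real eigenvalues and too close together for a focus. For `a < 0`, an earlier crossing
`(0, m)` satisfies the same scaled identity, and the signs of the two integrands rule it out. For `a
= 0` the imaginary part of the flow is positive before the half-turn. The pair `(0, 0)` with `a ≥ 0`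
is covered by the extension of the map. -/

theorem V_section (a T D y : ℝ) : V a T D (0, y) = D * y ^ 2 - a * T * y + a ^ 2 := by
  simp only [V]; ring

/-! ### Orbits -/

theorem exists_oscillator (κ : ℝ) : ∃ σ σ' : ℝ → ℝ, (∀ t, HasDerivAt σ (σ' t) t) ∧
    (∀ t, HasDerivAt σ' (κ * σ t) t) ∧ σ 0 = 0 ∧ σ' 0 = 1 := by
  rcases lt_trichotomy κ 0 with h | h | h
  · obtain ⟨ω, hω, rfl⟩ : ∃ ω : ℝ, 0 < ω ∧ κ = -ω ^ 2 :=
      ⟨√(-κ), Real.sqrt_pos.2 (by linarith), by rw [Real.sq_sqrt (by linarith)]; ring⟩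
    have hl (t : ℝ) : HasDerivAt (fun t => ω * t) ω t := by
      simpa using (hasDerivAt_id t).const_mul ω
    refine ⟨fun t => Real.sin (ω * t) / ω, fun t => Real.cos (ω * t), fun t => ?_, fun t => ?_,
      by simp, by simp⟩
    · exact ((hl t).sin.div_const ω).congr_deriv (by field_simp)
    · exact (hl t).cos.congr_deriv (by field_simp)
  · subst h
    exact ⟨fun t => t, fun _ => 1, fun t => hasDerivAt_id t,
      fun t => by simpa using hasDerivAt_const t (1 : ℝ), rfl, rfl⟩
  · obtain ⟨ω, hω, rfl⟩ : ∃ ω : ℝ, 0 < ω ∧ κ = ω ^ 2 :=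
      ⟨√κ, Real.sqrt_pos.2 h, (Real.sq_sqrt h.le).symm⟩
    have hl (t : ℝ) : HasDerivAt (fun t => ω * t) ω t := by
      simpa using (hasDerivAt_id t).const_mul ω
    refine ⟨fun t => Real.sinh (ω * t) / ω, fun t => Real.cosh (ω * t), fun t => ?_, fun t => ?_,
      by simp, by simp⟩
    · exact ((hl t).sinh.div_const ω).congr_deriv (by field_simp)
    · exact (hl t).cosh.congr_deriv (by field_simp)

/-- The solution `s` of `s'' - T s' + D s = 0`, `s(0) = 0`, `s'(0) = 1`, together with its
derivative and its primitive. -/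
structure IsFundamental (T D : ℝ) (s s' g : ℝ → ℝ) : Prop where
  hasDerivAt : ∀ t, HasDerivAt s (s' t) t
  hasDerivAt' : ∀ t, HasDerivAt s' (T * s' t - D * s t) t
  hasDerivAt_prim : ∀ t, HasDerivAt g (s t) t
  zero : s 0 = 0
  deriv_zero : s' 0 = 1
  prim_zero : g 0 = 0

theorem exists_isFundamental (T D : ℝ) : ∃ s s' g, IsFundamental T D s s' g := by
  -- The substitution `s = exp (T t / 2) σ` removes the damping term.
  obtain ⟨σ, σ', h1, h2, h3, h4⟩ := exists_oscillator (T ^ 2 / 4 - D)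
  have he (t : ℝ) : HasDerivAt (fun t => Real.exp (T / 2 * t)) (Real.exp (T / 2 * t) * (T / 2)) t := by
    have hl : HasDerivAt (fun t => T / 2 * t) (T / 2) t := by
      simpa using (hasDerivAt_id t).const_mul (T / 2)
    exact hl.exp
  have hs (t : ℝ) : HasDerivAt (fun t => Real.exp (T / 2 * t) * σ t)
      (Real.exp (T / 2 * t) * (σ' t + T / 2 * σ t)) t :=
    ((he t).mul (h1 t)).congr_deriv (by ring)
  have hc : Continuous fun t => Real.exp (T / 2 * t) * σ t :=
    continuous_iff_continuousAt.2 fun t => (hs t).continuousAt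
  refine ⟨_, _, fun t => ∫ r in (0 : ℝ)..t, Real.exp (T / 2 * r) * σ r, hs, fun t => ?_,
    fun t => ?_, by simp [h3], by simp [h3, h4], by simp⟩
  · exact ((he t).mul ((h2 t).add ((h1 t).const_mul (T / 2)))).congr_deriv
      (by simp only [Pi.add_apply]; ring)
  · exact intervalIntegral.integral_hasDerivAt_right (hc.intervalIntegrable _ _)
      (hc.stronglyMeasurableAtFilter _ _) hc.continuousAt

theorem eq_of_hasDerivAt_zero {f : ℝ → ℝ} (hf : ∀ t, HasDerivAt f 0 t) (t r : ℝ) : f t = f r :=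
  is_const_of_deriv_eq_zero (fun t => (hf t).differentiableAt) (fun t => (hf t).deriv) t r

theorem IsFundamental.deriv_eq {T D : ℝ} {s s' g : ℝ → ℝ} (h : IsFundamental T D s s' g) (t : ℝ) :
    s' t = 1 + T * s t - D * g t := by
  have := eq_of_hasDerivAt_zero (f := fun t => s' t - T * s t + D * g t) (fun t =>
    (((h.hasDerivAt' t).sub ((h.hasDerivAt t).const_mul T)).add
      ((h.hasDerivAt_prim t).const_mul D)).congr_deriv (by ring)) t 0
  simp only [h.zero, h.deriv_zero, h.prim_zero] at this
  linarith

theorem IsFundamental.isOrbitFrom {T D : ℝ} {s s' g : ℝ → ℝ} (h : IsFundamental T D s s' g)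
    (a y₀ : ℝ) : IsOrbitFrom a T D y₀
      (fun t => (a * g t - y₀ * s t, T * (a * g t - y₀ * s t) - (a * s t - y₀ * s' t))) := by
  refine ⟨by simp [h.zero, h.deriv_zero, h.prim_zero], fun t => ?_⟩
  have hx := ((h.hasDerivAt_prim t).const_mul a).sub ((h.hasDerivAt t).const_mul y₀)
  have hy := (hx.const_mul T).sub
    (((h.hasDerivAt t).const_mul a).sub ((h.hasDerivAt' t).const_mul y₀))
  refine (hx.prodMk hy).congr_deriv ?_
  simp only [vectorField, Prod.mk.injEq]
  refine ⟨by ring, ?_⟩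
  rw [h.deriv_eq]; ring

theorem exists_isOrbitFrom (a T D y₀ : ℝ) : ∃ Ψ, IsOrbitFrom a T D y₀ Ψ := by
  obtain ⟨s, s', g, h⟩ := exists_isFundamental T D
  exact ⟨_, h.isOrbitFrom a y₀⟩

section Orbit

variable {a T D y₀ : ℝ} {Ψ : ℝ → ℝ × ℝ}

theorem IsOrbitFrom.hasDerivAt_fst (h : IsOrbitFrom a T D y₀ Ψ) (t : ℝ) :
    HasDerivAt (fun t => (Ψ t).1) (T * (Ψ t).1 - (Ψ t).2) t :=
  (ContinuousLinearMap.fst ℝ ℝ ℝ).hasFDerivAt.comp_hasDerivAt t (h.2 t)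

theorem IsOrbitFrom.hasDerivAt_snd (h : IsOrbitFrom a T D y₀ Ψ) (t : ℝ) :
    HasDerivAt (fun t => (Ψ t).2) (D * (Ψ t).1 - a) t :=
  (ContinuousLinearMap.snd ℝ ℝ ℝ).hasFDerivAt.comp_hasDerivAt t (h.2 t)

theorem IsOrbitFrom.hasDerivAt_velocity (h : IsOrbitFrom a T D y₀ Ψ) (t : ℝ) :
    HasDerivAt (fun t => T * (Ψ t).1 - (Ψ t).2)
      (a - D * (Ψ t).1 + T * (T * (Ψ t).1 - (Ψ t).2)) t :=
  (((h.hasDerivAt_fst t).const_mul T).sub (h.hasDerivAt_snd t)).congr_deriv (by ring)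

theorem IsOrbitFrom.fst_zero (h : IsOrbitFrom a T D y₀ Ψ) : (Ψ 0).1 = 0 := by rw [h.1]

theorem IsOrbitFrom.snd_zero (h : IsOrbitFrom a T D y₀ Ψ) : (Ψ 0).2 = y₀ := by rw [h.1]

theorem IsOrbitFrom.continuous_fst (h : IsOrbitFrom a T D y₀ Ψ) : Continuous fun t => (Ψ t).1 :=
  continuous_iff_continuousAt.2 fun t => (h.hasDerivAt_fst t).continuousAt

theorem eventually_neg_of_hasDerivAt {f : ℝ → ℝ} {f' : ℝ} (hf : HasDerivAt f f' 0) (h0 : f 0 = 0)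
    (hf' : f' < 0) : ∀ᶠ t in 𝓝[>] (0 : ℝ), f t < 0 := by
  have h1 : Tendsto (slope f 0) (𝓝[>] 0) (𝓝 f') :=
    (hasDerivAt_iff_tendsto_slope.1 hf).mono_left (nhdsWithin_mono _ fun t ht => ne_of_gt ht)
  filter_upwards [h1.eventually_lt_const hf', self_mem_nhdsWithin] with t ht ht0
  rw [slope_def_field, h0, sub_zero, sub_zero] at ht
  have ht0 : 0 < t := ht0
  by_contra hc
  exact absurd ht (not_lt.2 (div_nonneg (not_lt.1 hc) ht0.le))

theorem eventually_neg_of_hasDerivAt_of_eventually_neg {f f' : ℝ → ℝ}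
    (hf : ∀ t, HasDerivAt f (f' t) t) (h0 : f 0 = 0) (hf' : ∀ᶠ t in 𝓝[>] (0 : ℝ), f' t < 0) :
    ∀ᶠ t in 𝓝[>] (0 : ℝ), f t < 0 := by
  obtain ⟨δ, hδ, h⟩ := mem_nhdsGT_iff_exists_Ioo_subset.1 hf'
  have hδ : 0 < δ := hδ
  refine mem_nhdsGT_iff_exists_Ioo_subset.2 ⟨δ, hδ, fun t ht => ?_⟩
  obtain ⟨r, hr, hr'⟩ := exists_hasDerivAt_eq_slope f f' ht.1
    (fun r _ => (hf r).continuousAt.continuousWithinAt) (fun r _ => hf r)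
  have h1 : f' r < 0 := h ⟨hr.1, hr.2.trans ht.2⟩
  rw [hr', h0, sub_zero, sub_zero] at h1
  by_contra hc
  exact absurd h1 (not_lt.2 (div_nonneg (not_lt.1 hc) ht.1.le))

/-- Initially `x' = -y₀`; at the tangency `y₀ = 0` this vanishes and `x'' = a` decides. -/
theorem IsOrbitFrom.eventually_fst_neg (h : IsOrbitFrom a T D y₀ Ψ)
    (h0 : 0 < y₀ ∨ y₀ = 0 ∧ a < 0) : ∀ᶠ t in 𝓝[>] (0 : ℝ), (Ψ t).1 < 0 := by
  rcases h0 with h0 | ⟨rfl, ha⟩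
  · exact eventually_neg_of_hasDerivAt (h.hasDerivAt_fst 0) h.fst_zero
      (by rw [h.fst_zero, h.snd_zero]; linarith)
  · exact eventually_neg_of_hasDerivAt_of_eventually_neg h.hasDerivAt_fst h.fst_zero
      (eventually_neg_of_hasDerivAt (h.hasDerivAt_velocity 0) (by rw [h.fst_zero, h.snd_zero]; ring)
        (by rw [h.fst_zero, h.snd_zero]; linarith))

theorem IsOrbitFrom.eventually_fst_pos (h : IsOrbitFrom a T D 0 Ψ) (ha : 0 < a) :
    ∀ᶠ t in 𝓝[>] (0 : ℝ), 0 < (Ψ t).1 := by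
  have := eventually_neg_of_hasDerivAt_of_eventually_neg (fun t => (h.hasDerivAt_fst t).neg)
    (by simp [h.fst_zero])
    (eventually_neg_of_hasDerivAt (h.hasDerivAt_velocity 0).neg
      (by simp [h.fst_zero, h.snd_zero])
      (by rw [h.fst_zero, h.snd_zero]; linarith))
  filter_upwards [this] with t ht
  exact neg_neg_iff_pos.1 ht

theorem IsOrbitFrom.returnsLeft (h : IsOrbitFrom a T D y₀ Ψ) {y₁ τ : ℝ}
    (h0 : 0 < y₀ ∨ y₀ = 0 ∧ a < 0) (hτ : 0 < τ) (hend : Ψ τ = (0, y₁))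
    (hne : ∀ t ∈ Set.Ioo 0 τ, (Ψ t).1 ≠ 0) : ReturnsLeft a T D y₀ y₁ τ := by
  refine ⟨h0.elim le_of_lt fun h => h.1.ge, hτ, Ψ, h, hend, fun t ht => ?_⟩
  obtain ⟨r, hr0, hr⟩ := ((h.eventually_fst_neg h0).and (Ioo_mem_nhdsGT hτ)).exists
  by_contra hc
  obtain ⟨m, hm, hm0⟩ := isPreconnected_Ioo.intermediate_value hr ht
    h.continuous_fst.continuousOn ⟨hr0.le, not_lt.1 hc⟩
  exact hne m hm hm0

end Orbit

/-! ### Integrals along the section -/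

section Section

variable {f : ℝ → ℝ} {y₀ y₁ : ℝ}

theorem hasDerivAt_primitive_of_continuousOn {U : Set ℝ} (hU : IsOpen U) (hc : ContinuousOn f U)
    {b y : ℝ} (hs : Set.uIcc b y ⊆ U) : HasDerivAt (fun y => ∫ r in b..y, f r) (f y) y := by
  have hy : U ∈ 𝓝 y := hU.mem_nhds (hs Set.right_mem_uIcc)
  exact intervalIntegral.integral_hasDerivAt_right ((hc.mono hs).intervalIntegrable)
    (hc.stronglyMeasurableAtFilter hU y (hs Set.right_mem_uIcc)) (hc.continuousAt hy)

/-- By continuity of the primitive at `0`, the removed gap contributes nothing in the limit. -/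
theorem HasPVIntegral.integral_eq {v : ℝ} (h : HasPVIntegral f y₁ y₀ v)
    (hf : IntervalIntegrable f volume y₁ y₀) : ∫ y in y₁..y₀, f y = v := by
  rcases h with h | ⟨h1, h0, -, h⟩
  · exact h.2
  · have h10 : y₁ ≤ y₀ := (h1.trans h0).le
    have hcont : ContinuousOn (fun y => ∫ r in y₁..y, f r) (Set.uIcc y₁ y₀) :=
      intervalIntegral.continuousOn_primitive_interval
        ((intervalIntegrable_iff_integrableOn_Icc_of_le h10).1 hf |>.mono_set
          (by rw [Set.uIcc_of_le h10]))
    have hc0 : ContinuousAt (fun y => ∫ r in y₁..y, f r) 0 :=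
      hcont.continuousAt (by rw [Set.uIcc_of_le h10]; exact Icc_mem_nhds h1 h0)
    have hl1 : Tendsto (fun ε : ℝ => ∫ r in y₁..(-ε), f r) (𝓝[>] 0) (𝓝 (∫ r in y₁..0, f r)) :=
      hc0.tendsto.comp (tendsto_nhdsWithin_of_tendsto_nhds (by
        simpa using (continuous_neg (G := ℝ)).tendsto 0))
    have hl2 : Tendsto (fun ε : ℝ => ∫ r in y₁..ε, f r) (𝓝[>] 0) (𝓝 (∫ r in y₁..0, f r)) :=
      tendsto_nhdsWithin_of_tendsto_nhds hc0.tendsto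
    have hl3 := hl1.add ((tendsto_const_nhds (x := ∫ r in y₁..y₀, f r)).sub hl2)
    refine tendsto_nhds_unique ?_ h
    rw [add_sub_cancel] at hl3
    refine hl3.congr' ?_
    filter_upwards [Ioo_mem_nhdsGT h0] with ε hε
    congr 1
    refine intervalIntegral.integral_interval_sub_left hf (hf.mono_set ?_)
    exact Set.uIcc_subset_uIcc_left (by
      rw [Set.uIcc_of_le h10]; exact ⟨(h1.trans hε.1).le, hε.2.le⟩)

end Section

theorem eq_of_hasDerivAt_zero_on_uIcc {E : Type*} [NormedAddCommGroup E] [NormedSpace ℝ E]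
    {f : ℝ → E} {b d : ℝ} (hf : ∀ y ∈ Set.uIcc b d, HasDerivAt f 0 y) : f d = f b := by
  have := (convex_uIcc b d).norm_image_sub_le_of_norm_hasDerivWithin_le (C := 0)
    (fun y hy => (hf y hy).hasDerivWithinAt) (by simp) Set.left_mem_uIcc Set.right_mem_uIcc
  rw [zero_mul, norm_le_zero_iff, sub_eq_zero] at this
  exact this

section SectionIdentities

variable {a T D y₀ y₁ : ℝ}

theorem continuous_V_section (a T D : ℝ) : Continuous fun y : ℝ => V a T D (0, y) := by
  simp only [V_section]; fun_prop

theorem isOpen_V_section_ne_zero (a T D : ℝ) : IsOpen {y : ℝ | V a T D (0, y) ≠ 0} :=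
  isOpen_ne_fun (continuous_V_section a T D) continuous_const

theorem continuousOn_neg_div_V (a T D : ℝ) :
    ContinuousOn (fun y => -y / V a T D (0, y)) {y : ℝ | V a T D (0, y) ≠ 0} :=
  continuous_neg.continuousOn.div (continuous_V_section a T D).continuousOn fun _ h => h

theorem continuousOn_const_div_V (a T D : ℝ) :
    ContinuousOn (fun y => a / V a T D (0, y)) {y : ℝ | V a T D (0, y) ≠ 0} :=
  continuousOn_const.div (continuous_V_section a T D).continuousOn fun _ h => h

theorem hasDerivAt_integral_neg_div_V (h : ∀ y ∈ Set.uIcc y₁ y₀, V a T D (0, y) ≠ 0) {y : ℝ}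
    (hy : y ∈ Set.uIcc y₁ y₀) :
    HasDerivAt (fun y => ∫ r in y₁..y, -r / V a T D (0, r)) (-y / V a T D (0, y)) y :=
  hasDerivAt_primitive_of_continuousOn (isOpen_V_section_ne_zero a T D)
    (continuousOn_neg_div_V a T D)
    fun _ hr => h _ (Set.uIcc_subset_uIcc_left hy hr)

theorem hasDerivAt_integral_const_div_V (h : ∀ y ∈ Set.uIcc y₁ y₀, V a T D (0, y) ≠ 0) {y : ℝ}
    (hy : y ∈ Set.uIcc y₁ y₀) :
    HasDerivAt (fun y => ∫ r in y₁..y, a / V a T D (0, r)) (a / V a T D (0, y)) y :=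
  hasDerivAt_primitive_of_continuousOn (isOpen_V_section_ne_zero a T D)
    (continuousOn_const_div_V a T D)
    fun _ hr => h _ (Set.uIcc_subset_uIcc_left hy hr)

theorem intervalIntegrable_neg_div_V (h : ∀ y ∈ Set.uIcc y₁ y₀, V a T D (0, y) ≠ 0) :
    IntervalIntegrable (fun y => -y / V a T D (0, y)) volume y₁ y₀ :=
  ((continuousOn_neg_div_V a T D).mono h).intervalIntegrable

theorem intervalIntegrable_const_div_V (h : ∀ y ∈ Set.uIcc y₁ y₀, V a T D (0, y) ≠ 0) :
    IntervalIntegrable (fun y => a / V a T D (0, y)) volume y₁ y₀ :=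
  ((continuousOn_const_div_V a T D).mono h).intervalIntegrable

/-- The flow of the system for the time `∫ a / V` maps `(0, y₀)` to `(0, y₁)` up to the scaling
`exp (D ∫ -y / V)` of the velocity. -/
theorem exp_mul_flow_eq {s s' g : ℝ → ℝ} (hs : IsFundamental T D s s' g)
    (h : ∀ y ∈ Set.uIcc y₁ y₀, V a T D (0, y) ≠ 0) {α β : ℝ}
    (hα : ∫ y in y₁..y₀, -y / V a T D (0, y) = α) (hβ : ∫ y in y₁..y₀, a / V a T D (0, y) = β) :
    Real.exp (D * α) * (a * (s' β - T * s β) + D * y₀ * s β) = a ∧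
      Real.exp (D * α) * (a * s β - y₀ * s' β) = -y₁ := by
  have hA {y : ℝ} (hy : y ∈ Set.uIcc y₁ y₀) := (hasDerivAt_integral_neg_div_V h hy).const_mul D
  have hB {y : ℝ} (hy : y ∈ Set.uIcc y₁ y₀) := hasDerivAt_integral_const_div_V h hy
  have hsB {y : ℝ} (hy : y ∈ Set.uIcc y₁ y₀) := (hs.hasDerivAt _).comp y (hB hy)
  have hsB' {y : ℝ} (hy : y ∈ Set.uIcc y₁ y₀) := (hs.hasDerivAt' _).comp y (hB hy)
  constructor
  -- With `y` in place of `y₀` in the endpoint and in the integrals, the left side has derivative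
  -- zero; at `y = y₁` both integrals vanish.
  · have := eq_of_hasDerivAt_zero_on_uIcc (b := y₁) (d := y₀) (fun y hy =>
      ((hA hy).exp.mul ((((hsB' hy).sub ((hsB hy).const_mul T)).const_mul a).add
        (((hasDerivAt_id y).const_mul D).mul (hsB hy)))).congr_deriv ?_)
    · simpa [hs.zero, hs.deriv_zero, hα, hβ] using this
    · have h0 := h y hy
      simp only [Pi.add_apply, Pi.mul_apply, Pi.sub_apply, Function.comp, id]
      field_simp
      rw [V_section]; ring
  · have := eq_of_hasDerivAt_zero_on_uIcc (b := y₁) (d := y₀) (fun y hy =>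
      ((hA hy).exp.mul (((hsB hy).const_mul a).sub
        ((hasDerivAt_id y).mul (hsB' hy)))).congr_deriv ?_)
    · simpa [hs.zero, hs.deriv_zero, hα, hβ] using this
    · have h0 := h y hy
      simp only [Pi.mul_apply, Pi.sub_apply, Function.comp, id]
      field_simp
      rw [V_section]; ring

/-- For `D = 0` the component `u = a - D x` no longer determines `x`. Instead `a g(B(y)) - y s(B(y))
- a A(y)` is constant along the section. -/
theorem prim_sub_eq_of_D_eq_zero {s s' g : ℝ → ℝ} (hs : IsFundamental T 0 s s' g)
    (h : ∀ y ∈ Set.uIcc y₁ y₀, V a T 0 (0, y) ≠ 0) {β : ℝ}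
    (hα : ∫ y in y₁..y₀, -y / V a T 0 (0, y) = 0) (hβ : ∫ y in y₁..y₀, a / V a T 0 (0, y) = β) :
    a * g β - y₀ * s β = 0 := by
  have hA {y : ℝ} (hy : y ∈ Set.uIcc y₁ y₀) := (hasDerivAt_integral_neg_div_V h hy).const_mul a
  have hB {y : ℝ} (hy : y ∈ Set.uIcc y₁ y₀) := hasDerivAt_integral_const_div_V h hy
  have := eq_of_hasDerivAt_zero_on_uIcc (b := y₁) (d := y₀) (fun y hy =>
      (((((hs.hasDerivAt_prim _).comp y (hB hy)).const_mul a).sub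
        ((hasDerivAt_id y).mul ((hs.hasDerivAt _).comp y (hB hy)))).sub (hA hy)).congr_deriv ?_)
  · simpa [hs.zero, hs.prim_zero, hα, hβ] using this
  · have h0 := h y hy
    simp only [Function.comp, id, hs.deriv_eq]
    field_simp
    rw [V_section]; ring

/-- Without scaling, the orbit through `(0, y₀)` passes through `(0, y₁)` after the time
`∫ a / V`. -/
theorem IsOrbitFrom.eq_of_integral_eq_zero
    (h : ∀ y ∈ Set.uIcc y₁ y₀, V a T D (0, y) ≠ 0)
    (hα : ∫ y in y₁..y₀, -y / V a T D (0, y) = 0) :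
    ∃ Ψ, IsOrbitFrom a T D y₀ Ψ ∧ Ψ (∫ y in y₁..y₀, a / V a T D (0, y)) = (0, y₁) := by
  obtain ⟨s, s', g, hs⟩ := exists_isFundamental T D
  refine ⟨_, hs.isOrbitFrom a y₀, ?_⟩
  obtain ⟨h1, h2⟩ := exp_mul_flow_eq hs h hα rfl
  simp only [mul_zero, Real.exp_zero, one_mul] at h1 h2
  set β := ∫ y in y₁..y₀, a / V a T D (0, y) with hβ
  have hx : a * g β - y₀ * s β = 0 := by
    rcases eq_or_ne D 0 with rfl | hD
    · exact prim_sub_eq_of_D_eq_zero hs h hα rfl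
    · refine (mul_eq_zero.1 (?_ : D * (a * g β - y₀ * s β) = 0)).resolve_left hD
      rw [hs.deriv_eq] at h1
      linarith
  simp only [hx, h2, Prod.mk.injEq, true_and]
  ring

end SectionIdentities

/-! ### The focus case -/

section Focus

variable {a T D ω y₀ y₁ : ℝ}

/-- The eigenvalue `T / 2 + i ω`. -/
noncomputable def eigenvalue (T ω : ℝ) : ℂ := ⟨T / 2, ω⟩

theorem eigenvalue_sq (hD : D = T ^ 2 / 4 + ω ^ 2) :
    eigenvalue T ω ^ 2 = T * eigenvalue T ω - D := by
  subst hD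
  apply Complex.ext <;> simp [eigenvalue, pow_two] <;> ring

theorem ofReal_add_mul_eigenvalue_inj (hω : ω ≠ 0) {b d b' d' : ℝ}
    (h : (b : ℂ) + eigenvalue T ω * d = b' + eigenvalue T ω * d') : b = b' ∧ d = d' := by
  have h1 := congrArg Complex.re h
  have h2 := congrArg Complex.im h
  simp only [eigenvalue, Complex.add_re, Complex.mul_re, Complex.ofReal_re, Complex.ofReal_im,
    mul_zero, sub_zero, Complex.add_im, Complex.mul_im, zero_add] at h1 h2
  have h3 : d = d' := mul_left_cancel₀ hω h2
  subst h3
  exact ⟨by linarith, rfl⟩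

theorem sub_eigenvalue_mul_ne_zero (hω : ω ≠ 0) (h : a ≠ 0 ∨ y₀ ≠ 0) :
    (a : ℂ) - eigenvalue T ω * y₀ ≠ 0 := by
  intro h0
  have := ofReal_add_mul_eigenvalue_inj (T := T) hω (b := a) (d := -y₀) (b' := 0) (d' := 0)
    (by push_cast; linear_combination h0)
  rcases h with h | h
  · exact h this.1
  · exact h (neg_eq_zero.1 this.2)

theorem exp_real_add_eigenvalue_mul_eq_one {ω : ℝ} {b t : ℝ}
    (h : Complex.exp (eigenvalue T ω * t + b) = 1) :
    ∃ n : ℤ, ω * t = n * (2 * Real.pi) ∧ T / 2 * t + b = 0 := by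
  obtain ⟨n, hn⟩ := Complex.exp_eq_one_iff.1 h
  refine ⟨n, ?_, ?_⟩
  · simpa [eigenvalue] using congrArg Complex.im hn
  · simpa [eigenvalue] using congrArg Complex.re hn

theorem exp_eigenvalue_mul_im (T ω t : ℝ) : (Complex.exp (eigenvalue T ω * t)).im =
    Real.exp (T / 2 * t) * Real.sin (ω * t) := by
  simp [Complex.exp_im, eigenvalue]

/-- Since `μ² = T μ - D`, the complex coordinate `w = u + μ v` satisfies `w' = μ w`. -/
theorem IsOrbitFrom.complex_flow {Ψ : ℝ → ℝ × ℝ} (h : IsOrbitFrom a T D y₀ Ψ)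
    (hD : D = T ^ 2 / 4 + ω ^ 2) (t r : ℝ) :
    (((a - D * (Ψ t).1 : ℝ) : ℂ) + eigenvalue T ω * ((T * (Ψ t).1 - (Ψ t).2 : ℝ) : ℂ)) =
      Complex.exp (eigenvalue T ω * ((t - r : ℝ) : ℂ)) *
      (((a - D * (Ψ r).1 : ℝ) : ℂ) + eigenvalue T ω * ((T * (Ψ r).1 - (Ψ r).2 : ℝ) : ℂ)) := by
  have hl := eigenvalue_sq (T := T) hD
  set μ := eigenvalue T ω
  have hp (t : ℝ) := (((h.hasDerivAt_fst t).const_mul D).const_sub a).ofReal_comp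
  have hq (t : ℝ) := (h.hasDerivAt_velocity t).ofReal_comp
  have he (t : ℝ) := (((hasDerivAt_id t).ofReal_comp).const_mul (-μ)).cexp
  have := eq_of_hasDerivAt_zero_on_uIcc (b := r) (d := t) (fun t _ =>
    ((he t).mul ((hp t).add ((hq t).const_mul μ))).congr_deriv ?_)
  · simp only [Pi.mul_apply, Pi.add_apply, id] at this
    have h2 := congrArg (fun z => Complex.exp (μ * t) * z) this
    simp only [← mul_assoc, ← Complex.exp_add] at h2
    rw [show μ * t + -μ * t = 0 by ring, Complex.exp_zero, one_mul] at h2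
    rw [h2]
    congr 2
    push_cast; ring
  · simp only [Pi.add_apply, id]
    push_cast
    linear_combination (-Complex.exp (-μ * t) * (T * (Ψ t).1 - (Ψ t).2)) * hl

theorem IsOrbitFrom.complex_flow_zero {Ψ : ℝ → ℝ × ℝ} (h : IsOrbitFrom a T D y₀ Ψ)
    (hD : D = T ^ 2 / 4 + ω ^ 2) (t : ℝ) :
    (((a - D * (Ψ t).1 : ℝ) : ℂ) + eigenvalue T ω * ((T * (Ψ t).1 - (Ψ t).2 : ℝ) : ℂ)) =
      Complex.exp (eigenvalue T ω * t) * (a - eigenvalue T ω * y₀) := by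
  rw [h.complex_flow hD t 0, h.fst_zero, h.snd_zero]
  push_cast
  ring_nf

theorem IsOrbitFrom.eq_of_exp_eq {Ψ : ℝ → ℝ × ℝ} (h : IsOrbitFrom a T D y₀ Ψ) (hω : ω ≠ 0)
    (hD : D = T ^ 2 / 4 + ω ^ 2) {t : ℝ}
    (ht : Complex.exp (eigenvalue T ω * t) * (a - eigenvalue T ω * y₀) =
      a - eigenvalue T ω * y₁) : Ψ t = (0, y₁) := by
  have h1 := h.complex_flow_zero hD t
  rw [ht] at h1
  obtain ⟨h2, h3⟩ := ofReal_add_mul_eigenvalue_inj (T := T) hω (b' := a) (d' := -y₁)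
    (h1.trans (by push_cast; ring))
  have hD0 : D ≠ 0 := by rw [hD]; positivity
  have hx : (Ψ t).1 = 0 := (mul_eq_zero.1 (by linarith : D * (Ψ t).1 = 0)).resolve_left hD0
  rw [hx] at h3
  exact Prod.ext hx (by simp only; linarith)

theorem IsOrbitFrom.exp_eq_of_fst_eq_zero {Ψ : ℝ → ℝ × ℝ} (h : IsOrbitFrom a T D y₀ Ψ)
    (hD : D = T ^ 2 / 4 + ω ^ 2) {t : ℝ} (ht : (Ψ t).1 = 0) :
    Complex.exp (eigenvalue T ω * t) * (a - eigenvalue T ω * y₀) =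
      a - eigenvalue T ω * (Ψ t).2 := by
  rw [← h.complex_flow_zero hD t, ht]
  push_cast; ring

theorem exp_mul_complex_flow_eq (hD : D = T ^ 2 / 4 + ω ^ 2)
    (h : ∀ y ∈ Set.uIcc y₁ y₀, V a T D (0, y) ≠ 0) {α β : ℝ}
    (hα : ∫ y in y₁..y₀, -y / V a T D (0, y) = α) (hβ : ∫ y in y₁..y₀, a / V a T D (0, y) = β) :
    Complex.exp (D * α + eigenvalue T ω * β) * (a - eigenvalue T ω * y₀) =
      a - eigenvalue T ω * y₁ := by
  have hl := eigenvalue_sq (T := T) hD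
  set μ := eigenvalue T ω
  have := eq_of_hasDerivAt_zero_on_uIcc (b := y₁) (d := y₀) (fun y hy =>
      (((((hasDerivAt_integral_neg_div_V h hy).ofReal_comp.const_mul (D : ℂ)).add
        ((hasDerivAt_integral_const_div_V h hy).ofReal_comp.const_mul μ)).cexp).mul
        (((hasDerivAt_id y).ofReal_comp.const_mul μ).const_sub (a : ℂ))).congr_deriv ?_)
  · simpa [hα, hβ] using this
  · have h0 : ((V a T D (0, y) : ℝ) : ℂ) ≠ 0 := by exact_mod_cast h y hy
    simp only [Pi.add_apply, id]
    push_cast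
    rw [mul_assoc, ← mul_add]
    refine mul_eq_zero_of_right _ ?_
    field_simp
    rw [V_section]; push_cast
    linear_combination (-(a * y : ℂ)) * hl

theorem V_section_pos (hω : ω ≠ 0) (hD : D = T ^ 2 / 4 + ω ^ 2) (ha : a ≠ 0) (y : ℝ) :
    0 < V a T D (0, y) := by
  have : V a T D (0, y) = (T / 2 * y - a) ^ 2 + ω ^ 2 * y ^ 2 := by rw [V_section, hD]; ring
  rw [this]
  rcases eq_or_ne y 0 with rfl | hy
  · simpa using pow_pos (abs_pos.2 ha) 2
  · positivity

/-- The integrand has an arctangent primitive divided by `ω`, whose total variation is less than `π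
/ ω`. -/
theorem abs_integral_const_div_V_lt (hω : 0 < ω) (hD : D = T ^ 2 / 4 + ω ^ 2) (ha : a ≠ 0)
    (y₁ y₀ : ℝ) : |∫ y in y₁..y₀, a / V a T D (0, y)| < Real.pi / ω := by
  have hV := V_section_pos hω.ne' hD ha
  have hd (y : ℝ) : HasDerivAt (fun y => Real.arctan ((D * y - a * T / 2) / (a * ω)) / ω)
      (a / V a T D (0, y)) y := by
    refine ((((hasDerivAt_id y).const_mul D).sub_const (a * T / 2)).div_const
      (a * ω)).arctan.div_const ω |>.congr_deriv ?_
    have h0 := (hV y).ne'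
    have hD0 : D ≠ 0 := by rw [hD]; positivity
    have h1 : 1 + ((D * y - a * T / 2) / (a * ω)) ^ 2 = D * V a T D (0, y) / (a * ω) ^ 2 := by
      rw [V_section]
      field_simp
      rw [hD]; ring
    simp only [id]
    rw [h1]
    field_simp
  rw [intervalIntegral.integral_eq_sub_of_hasDerivAt (fun y _ => hd y)
    (intervalIntegrable_const_div_V fun y _ => (hV y).ne'), ← sub_div, abs_div, abs_of_pos hω]
  refine div_lt_div_of_pos_right ?_ hω
  rw [abs_lt]
  constructor <;>
  linarith [Real.arctan_lt_pi_div_two ((D * y₀ - a * T / 2) / (a * ω)),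
    Real.neg_pi_div_two_lt_arctan ((D * y₀ - a * T / 2) / (a * ω)),
    Real.arctan_lt_pi_div_two ((D * y₁ - a * T / 2) / (a * ω)),
    Real.neg_pi_div_two_lt_arctan ((D * y₁ - a * T / 2) / (a * ω))]

end Focus

/-! ### The case `a > 0` -/

section Positive

variable {a T D ω y₀ y₁ : ℝ}

/-- With `l`, `T - l` the real eigenvalues, `u + l v` is a multiple of `exp (l t)`, and up to an
exponential factor it is the derivative of `exp (-(T - l) t) v`. Rolle's theorem gives it a zero, so
it vanishes identically, and then so does `v`. -/
theorem IsOrbitFrom.eq_zero_of_velocity_zeros {Ψ : ℝ → ℝ × ℝ} (h : IsOrbitFrom a T D y₀ Ψ)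
    (hd : 4 * D - T ^ 2 ≤ 0) {z₁ z₂ : ℝ} (hz : z₁ < z₂)
    (h1 : T * (Ψ z₁).1 - (Ψ z₁).2 = 0) (h2 : T * (Ψ z₂).1 - (Ψ z₂).2 = 0) : y₀ = 0 := by
  obtain ⟨l, hl⟩ : ∃ l : ℝ, l * (T - l) = D := by
    refine ⟨(T + √(T ^ 2 - 4 * D)) / 2, ?_⟩
    linear_combination (-1 / 4 : ℝ) * Real.sq_sqrt (show 0 ≤ T ^ 2 - 4 * D by linarith)
  have he (k t : ℝ) : HasDerivAt (fun t => Real.exp (-k * t)) (Real.exp (-k * t) * (-k)) t := by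
    have : HasDerivAt (fun t => -k * t) (-k) t := by simpa using (hasDerivAt_id t).const_mul (-k)
    exact this.exp
  have hr (t : ℝ) : HasDerivAt (fun t => Real.exp (-(T - l) * t) * (T * (Ψ t).1 - (Ψ t).2))
      (Real.exp (-(T - l) * t) * (a - D * (Ψ t).1 + l * (T * (Ψ t).1 - (Ψ t).2))) t :=
    ((he (T - l) t).mul (h.hasDerivAt_velocity t)).congr_deriv (by ring)
  have hm (t : ℝ) : HasDerivAt
      (fun t => Real.exp (-l * t) * (a - D * (Ψ t).1 + l * (T * (Ψ t).1 - (Ψ t).2))) 0 t := by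
    refine ((he l t).mul ((((h.hasDerivAt_fst t).const_mul D).const_sub a).add
      ((h.hasDerivAt_velocity t).const_mul l))).congr_deriv ?_
    simp only [Pi.add_apply]
    linear_combination Real.exp (-l * t) * (T * (Ψ t).1 - (Ψ t).2) * hl
  obtain ⟨z, -, hz0⟩ := exists_hasDerivAt_eq_zero hz
    (fun t _ => (hr t).continuousAt.continuousWithinAt) (by simp only [h1, h2, mul_zero])
    fun t _ => hr t
  have hz0 := (mul_eq_zero.1 hz0).resolve_left (Real.exp_ne_zero _)
  have hm0 (t : ℝ) : a - D * (Ψ t).1 + l * (T * (Ψ t).1 - (Ψ t).2) = 0 := by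
    have := eq_of_hasDerivAt_zero hm t z
    simp only [hz0, mul_zero] at this
    exact (mul_eq_zero.1 this).resolve_left (Real.exp_ne_zero _)
  have := eq_of_hasDerivAt_zero (fun t => by simpa only [hm0, mul_zero] using hr t) 0 z₁
  simpa [h1, h.fst_zero, h.snd_zero] using this

/-- If `v` vanishes at both times, the imaginary part of `w` is a positive sine factor times
`u(z₁)`; hence `w(z₁) = 0` and the orbit is an equilibrium. -/
theorem IsOrbitFrom.eq_zero_of_velocity_zeros_focus {Ψ : ℝ → ℝ × ℝ} (h : IsOrbitFrom a T D y₀ Ψ)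
    (hω : 0 < ω) (hD : D = T ^ 2 / 4 + ω ^ 2) {z₁ z₂ : ℝ} (hz : z₁ < z₂)
    (hz' : z₂ - z₁ < Real.pi / ω)
    (h1 : T * (Ψ z₁).1 - (Ψ z₁).2 = 0) (h2 : T * (Ψ z₂).1 - (Ψ z₂).2 = 0) : y₀ = 0 := by
  have h3 := congrArg Complex.im (h.complex_flow hD z₂ z₁)
  rw [h1, h2, Complex.ofReal_zero, mul_zero, add_zero, add_zero, Complex.ofReal_im,
    Complex.im_mul_ofReal, exp_eigenvalue_mul_im] at h3
  have hs : 0 < Real.sin (ω * (z₂ - z₁)) :=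
    Real.sin_pos_of_pos_of_lt_pi (mul_pos hω (sub_pos.2 hz))
      (by rw [lt_div_iff₀ hω] at hz'; linarith)
  have h4 : a - D * (Ψ z₁).1 = 0 :=
    (mul_eq_zero.1 h3.symm).resolve_left (mul_pos (Real.exp_pos _) hs).ne'
  have h5 := h.complex_flow_zero hD z₁
  rw [h4, h1, Complex.ofReal_zero, mul_zero, add_zero] at h5
  by_contra hy
  exact mul_ne_zero (Complex.exp_ne_zero _) (sub_eigenvalue_mul_ne_zero hω.ne' (Or.inr hy)) h5.symm

theorem exists_angular_frequency (h : 0 < 4 * D - T ^ 2) :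
    ∃ ω : ℝ, 0 < ω ∧ D = T ^ 2 / 4 + ω ^ 2 ∧ √(4 * D - T ^ 2) = 2 * ω := by
  refine ⟨√(4 * D - T ^ 2) / 2, half_pos (Real.sqrt_pos.2 h), ?_, by ring⟩
  rw [div_pow, Real.sq_sqrt h.le]; ring

theorem returnsLeft_of_integral_eq_zero (ha : 0 < a) (hy₁ : y₁ < 0) (hy₀ : 0 < y₀)
    (hV : ∀ y ∈ Set.Icc y₁ y₀, 0 < V a T D (0, y))
    (hα : ∫ y in y₁..y₀, -y / V a T D (0, y) = 0) :
    ReturnsLeft a T D y₀ y₁ (∫ y in y₁..y₀, a / V a T D (0, y)) := by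
  have hV' : ∀ y ∈ Set.uIcc y₁ y₀, V a T D (0, y) ≠ 0 := fun y hy =>
    (hV y (by rwa [Set.uIcc_of_le (hy₁.trans hy₀).le] at hy)).ne'
  obtain ⟨Ψ, h, hend⟩ := IsOrbitFrom.eq_of_integral_eq_zero hV' hα
  have hτ : 0 < ∫ y in y₁..y₀, a / V a T D (0, y) :=
    intervalIntegral.intervalIntegral_pos_of_pos_on (intervalIntegrable_const_div_V hV')
      (fun y hy => div_pos ha (hV y (Set.Ioo_subset_Icc_self hy))) (hy₁.trans hy₀)
  have hlt (ω : ℝ) (hω : 0 < ω) (hD : D = T ^ 2 / 4 + ω ^ 2) :=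
    (abs_lt.1 (abs_integral_const_div_V_lt hω hD ha.ne' y₁ y₀)).2
  set τ := ∫ y in y₁..y₀, a / V a T D (0, y)
  -- An intermediate return splits `(0, τ)` into two Rolle intervals, each with a zero of `x'`.
  refine h.returnsLeft (Or.inl hy₀) hτ hend fun t ht ht0 => hy₀.ne' ?_
  have hc (b d : ℝ) : ContinuousOn (fun t => (Ψ t).1) (Set.Icc b d) := h.continuous_fst.continuousOn
  obtain ⟨z₁, hz₁, h1⟩ := exists_hasDerivAt_eq_zero ht.1 (hc _ _) (by rw [ht0, h.fst_zero])
    fun t _ => h.hasDerivAt_fst t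
  obtain ⟨z₂, hz₂, h2⟩ := exists_hasDerivAt_eq_zero ht.2 (hc _ _) (by rw [ht0, hend])
    fun t _ => h.hasDerivAt_fst t
  have hz : z₁ < z₂ := hz₁.2.trans hz₂.1
  rcases le_or_gt (4 * D - T ^ 2) 0 with hd | hd
  · exact h.eq_zero_of_velocity_zeros hd hz h1 h2
  · obtain ⟨ω, hω, hD, -⟩ := exists_angular_frequency hd
    exact h.eq_zero_of_velocity_zeros_focus hω hD hz
      (by linarith [hlt ω hω hD, hz₁.1, hz₂.2]) h1 h2

theorem extendsToOrigin_of_pos (ha : 0 < a) : ExtendsToOrigin a T D := by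
  constructor
  · rintro ⟨y₁, τ, -, hτ, Ψ, h, -, hneg⟩
    obtain ⟨t, ht, htτ⟩ := ((h.eventually_fst_pos ha).and (Ioo_mem_nhdsGT hτ)).exists
    exact lt_asymm ht (hneg t htτ)
  · intro ε hε
    have h0 : ∀ᶠ y in 𝓝 (0 : ℝ), 0 < V a T D (0, y) :=
      (continuous_V_section a T D).continuousAt.eventually_const_lt
        (by simp only [V_section]; simpa using pow_pos ha 2)
    obtain ⟨δ', hδ', hball⟩ := Metric.eventually_nhds_iff.1 h0
    obtain ⟨δ, hδ, hδm⟩ := exists_between (lt_min hε hδ')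
    have hδε := hδm.trans_le (min_le_left _ _)
    have hpos : ∀ y ∈ Set.Icc (-δ) δ, 0 < V a T D (0, y) := fun y hy => hball (by
      rw [Real.dist_eq, sub_zero]
      exact (abs_le.2 hy).trans_lt (hδm.trans_le (min_le_right _ _)))
    have hsub {b d : ℝ} (hb : b ∈ Set.Icc (-δ) δ) (hd : d ∈ Set.Icc (-δ) δ) :
        ∀ y ∈ Set.uIcc b d, V a T D (0, y) ≠ 0 := fun y hy =>
      (hpos y (Set.OrdConnected.uIcc_subset Set.ordConnected_Icc hb hd hy)).ne'
    have hz : (0 : ℝ) ∈ Set.Icc (-δ) δ := ⟨by linarith, hδ.le⟩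
    have hl : -δ ∈ Set.Icc (-δ) δ := ⟨le_rfl, by linarith⟩
    have hr : δ ∈ Set.Icc (-δ) δ := ⟨by linarith, le_rfl⟩
    -- `G` vanishes at `0` and is negative at `±δ`. The intermediate value theorem matches the
    -- endpoint value nearer to zero on the opposite side, and equal values of `G` mean a zero
    -- integral.
    set G : ℝ → ℝ := fun y => ∫ r in (0 : ℝ)..y, -r / V a T D (0, r) with hG
    have hGc : ContinuousOn G (Set.Icc (-δ) δ) := fun y hy =>
      (hasDerivAt_integral_neg_div_V (hsub hz hy)
        Set.right_mem_uIcc).continuousAt.continuousWithinAt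
    have hG0 : G 0 = 0 := intervalIntegral.integral_same
    have hGr : G δ < 0 := by
      have := intervalIntegral.intervalIntegral_pos_of_pos_on
        (intervalIntegrable_neg_div_V (hsub hz hr)).neg (fun y hy => by
          rw [Pi.neg_apply, ← neg_div, neg_neg]
          exact div_pos hy.1 (hpos y ⟨by linarith [hy.1], hy.2.le⟩)) hδ
      simpa only [Pi.neg_apply, intervalIntegral.integral_neg, neg_pos] using this
    have hGl : G (-δ) < 0 := by
      have := intervalIntegral.intervalIntegral_pos_of_pos_on
        (intervalIntegrable_neg_div_V (hsub hl hz)) (fun y hy =>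
          div_pos (neg_pos.2 hy.2) (hpos y ⟨hy.1.le, by linarith [hy.2]⟩)) (neg_lt_zero.2 hδ)
      rw [hG]
      simp only
      rw [intervalIntegral.integral_symm]
      linarith
    have key {y₀ y₁ : ℝ} (h1 : y₁ ∈ Set.Ico (-δ) 0) (h2 : y₀ ∈ Set.Ioc 0 δ) (h3 : G y₁ = G y₀) :
        ∃ y₀ ∈ Set.Ioo 0 ε, ∃ y₁ ∈ Set.Ioo (-ε) 0, ∃ τ : ℝ, ReturnsLeft a T D y₀ y₁ τ := by
      have hm1 : y₁ ∈ Set.Icc (-δ) δ := ⟨h1.1, by linarith [h1.2]⟩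
      have hm0 : y₀ ∈ Set.Icc (-δ) δ := ⟨by linarith [h2.1], h2.2⟩
      refine ⟨y₀, ⟨h2.1, h2.2.trans_lt hδε⟩, y₁, ⟨by linarith [h1.1], h1.2⟩, _,
        returnsLeft_of_integral_eq_zero ha h1.2 h2.1
          (fun y hy => hpos y ⟨h1.1.trans hy.1, hy.2.trans h2.2⟩) ?_⟩
      rw [← intervalIntegral.integral_interval_sub_left
        (intervalIntegrable_neg_div_V (hsub hz hm0)) (intervalIntegrable_neg_div_V (hsub hz hm1))]
      exact sub_eq_zero.2 h3.symm
    rcases le_total (G (-δ)) (G δ) with hle | hle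
    · obtain ⟨y₁, hy₁, he⟩ := intermediate_value_Icc (neg_nonpos.2 hδ.le)
        (hGc.mono (Set.Icc_subset_Icc_right hδ.le)) ⟨hle, by rw [hG0]; exact hGr.le⟩
      refine key ⟨hy₁.1, lt_of_le_of_ne hy₁.2 ?_⟩ ⟨hδ, le_rfl⟩ he
      rintro rfl
      exact hGr.ne (he.symm.trans hG0)
    · obtain ⟨y₀, hy₀, he⟩ := intermediate_value_Icc' hδ.le
        (hGc.mono (Set.Icc_subset_Icc_left (neg_nonpos.2 hδ.le))) ⟨hle, by rw [hG0]; exact hGl.le⟩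
      refine key ⟨le_rfl, neg_lt_zero.2 hδ⟩ ⟨lt_of_le_of_ne hy₀.1 ?_, hy₀.2⟩ he.symm
      rintro rfl
      exact hGl.ne (he.symm.trans hG0)

/-- The line `l² x - l y + a = 0` lies in the zero set of `V`, so its left side keeps one sign on
the component. A nonpositive sign would give `l ξ₁, l ξ₂ ≥ a > 0`, against `ξ₁ ξ₂ < 0`. -/
theorem sub_mul_pos_of_mem_mainInterval (ha : 0 < a) {y l : ℝ} (hy : y ∈ mainInterval a T D)
    (hl : l * (T - l) = D) : 0 < a - l * y := by
  have hm : ((0, y) : ℝ × ℝ) ∈ mainComponent a T D ∪ {(0, 0)} := interior_subset hy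
  rcases hm with ⟨ξ₁, ξ₂, hξ, h1, h2⟩ | h0
  · set S := {q | V a T D q ≠ 0}
    have hyS : ((0, y) : ℝ × ℝ) ∈ S := connectedComponentIn_nonempty_iff.1 ⟨_, h1⟩
    have hyK := mem_connectedComponentIn hyS
    have hne : ∀ p ∈ connectedComponentIn S (0, y), l ^ 2 * p.1 - l * p.2 + a ≠ 0 := by
      intro p hp h0
      refine connectedComponentIn_subset _ _ hp ?_
      have : V a T D p = (l ^ 2 * p.1 - l * p.2 + a) *
          ((T - l) ^ 2 * p.1 - (T - l) * p.2 + a) := by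
        rw [V, ← hl]; ring
      rw [this, h0, zero_mul]
    have key : ∀ ξ : ℝ, (0, ξ) ∈ connectedComponentIn S (0, y) → 0 < a - l * ξ →
        0 < a - l * y := by
      intro ξ hξ hpos
      by_contra hc
      obtain ⟨p, hp, hp0⟩ := isPreconnected_connectedComponentIn.intermediate_value hyK hξ
        (f := fun p : ℝ × ℝ => l ^ 2 * p.1 - l * p.2 + a) (by fun_prop)
        (show (0 : ℝ) ∈ _ from ⟨by simp only; linarith, by simp only; linarith⟩)
      exact hne p hp hp0
    by_contra hc
    have h3 := le_of_not_gt fun h => hc (key ξ₁ h1 h)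
    have h4 := le_of_not_gt fun h => hc (key ξ₂ h2 h)
    have h5 : 0 < (l * ξ₁) * (l * ξ₂) := mul_pos (by linarith) (by linarith)
    nlinarith [sq_nonneg l]
  · have : y = 0 := congrArg Prod.snd h0
    simpa [this] using ha

theorem V_pos_of_mem_mainInterval (ha : 0 < a) (hy₁ : y₁ ∈ mainInterval a T D)
    (hy₀ : y₀ ∈ mainInterval a T D) {y : ℝ} (hy : y ∈ Set.Icc y₁ y₀) : 0 < V a T D (0, y) := by
  rcases le_or_gt (4 * D - T ^ 2) 0 with hd | hd
  · obtain ⟨l, hl⟩ : ∃ l : ℝ, l * (T - l) = D := by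
      refine ⟨(T + √(T ^ 2 - 4 * D)) / 2, ?_⟩
      linear_combination (-1 / 4 : ℝ) * Real.sq_sqrt (show 0 ≤ T ^ 2 - 4 * D by linarith)
    have key (k : ℝ) (hk : k * (T - k) = D) : 0 < a - k * y := by
      have h1 := sub_mul_pos_of_mem_mainInterval ha hy₁ hk
      have h0 := sub_mul_pos_of_mem_mainInterval ha hy₀ hk
      rcases le_total 0 k with h | h
      · linarith [mul_le_mul_of_nonneg_left hy.2 h]
      · linarith [mul_le_mul_of_nonpos_left hy.1 h]
    have : V a T D (0, y) = (a - l * y) * (a - (T - l) * y) := by rw [V_section, ← hl]; ring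
    rw [this]
    exact mul_pos (key l hl) (key (T - l) (by linarith))
  · obtain ⟨ω, hω, hD, -⟩ := exists_angular_frequency hd
    exact V_section_pos hω.ne' hD ha.ne' y

end Positive

/-! ### The case `a = 0` -/

section Zero

variable {T D ω y₀ y₁ : ℝ}

theorem eigenvalue_mul_ofReal (T ω t : ℝ) :
    eigenvalue T ω * t = ((T / 2 * t : ℝ) : ℂ) + ((ω * t : ℝ) : ℂ) * Complex.I := by
  apply Complex.ext <;> simp [eigenvalue]

theorem exp_eigenvalue_half_turn (hω : ω ≠ 0) :
    Complex.exp (eigenvalue T ω * (Real.pi / ω : ℝ)) = -(Real.exp (Real.pi * T / (2 * ω)) : ℝ) := by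
  have : eigenvalue T ω * (Real.pi / ω : ℝ) =
      ((Real.pi * T / (2 * ω) : ℝ) : ℂ) + Real.pi * Complex.I := by
    rw [eigenvalue_mul_ofReal, mul_div_cancel₀ _ hω,
      show T / 2 * (Real.pi / ω) = Real.pi * T / (2 * ω) by ring]
  rw [this, Complex.exp_add, Complex.exp_pi_mul_I, Complex.ofReal_exp]
  ring

theorem returnsLeft_zero (hω : 0 < ω) (hD : D = T ^ 2 / 4 + ω ^ 2) (hy₀ : 0 < y₀) :
    ReturnsLeft 0 T D y₀ (-(Real.exp (Real.pi * T / (2 * ω)) * y₀)) (Real.pi / ω) := by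
  obtain ⟨Ψ, h⟩ := exists_isOrbitFrom 0 T D y₀
  refine h.returnsLeft (Or.inl hy₀) (div_pos Real.pi_pos hω) (h.eq_of_exp_eq hω.ne' hD ?_)
    fun t ht ht0 => ?_
  · rw [exp_eigenvalue_half_turn hω.ne']
    push_cast; ring
  · have h1 := h.complex_flow_zero hD t
    rw [ht0] at h1
    have hs : 0 < Real.sin (ω * t) := Real.sin_pos_of_pos_of_lt_pi (mul_pos hω ht.1)
      (by have := ht.2; rw [lt_div_iff₀ hω] at this; linarith)
    have h2 : eigenvalue T ω * (((Ψ t).2 : ℂ) - Complex.exp (eigenvalue T ω * t) * y₀) = 0 := by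
      push_cast at h1
      linear_combination -h1
    have hne : eigenvalue T ω ≠ 0 := fun h0 => hω.ne' (congrArg Complex.im h0)
    have h3 := congrArg Complex.im ((mul_eq_zero.1 h2).resolve_left hne)
    rw [Complex.sub_im, Complex.ofReal_im, Complex.im_mul_ofReal, exp_eigenvalue_mul_im,
      Complex.zero_im, zero_sub, neg_eq_zero] at h3
    exact (mul_pos (mul_pos (Real.exp_pos _) hs) hy₀).ne' h3

theorem extendsToOrigin_zero (hω : 0 < ω) (hD : D = T ^ 2 / 4 + ω ^ 2) :
    ExtendsToOrigin 0 T D := by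
  constructor
  · rintro ⟨y₁, τ, -, hτ, Ψ, h, -, hneg⟩
    have hm : τ / 2 ∈ Set.Ioo 0 τ := ⟨half_pos hτ, half_lt_self hτ⟩
    -- The origin is an equilibrium, so `x` stays zero.
    have h1 := h.complex_flow_zero hD (τ / 2)
    have h2 := (ofReal_add_mul_eigenvalue_inj (T := T) hω.ne' (b' := 0) (d' := 0)
      (h1.trans (by simp))).1
    have hD0 : 0 < D := by rw [hD]; positivity
    nlinarith [hneg _ hm]
  · intro ε hε
    set E := Real.exp (Real.pi * T / (2 * ω))
    have hE : 0 < E := Real.exp_pos _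
    -- The choice `y₀ = ε / (2 (E + 1))` keeps both `y₀` and `E y₀` below `ε`.
    have hq : ε / (E + 1) * (E + 1) = ε := div_mul_cancel₀ _ (by positivity)
    have hy : 0 < ε / (E + 1) / 2 := by positivity
    refine ⟨ε / (E + 1) / 2, ⟨hy, ?_⟩, -(E * (ε / (E + 1) / 2)), ⟨?_, ?_⟩, _,
      returnsLeft_zero hω hD hy⟩ <;> nlinarith [mul_pos hE hy]

theorem neg_div_V_zero (hD : D ≠ 0) (y : ℝ) : -y / V 0 T D (0, y) = -D⁻¹ * y⁻¹ := by
  rw [V_section]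
  rcases eq_or_ne y 0 with rfl | hy
  · simp
  · field_simp; ring

/-- The integrand is `-1 / (D y)`, not integrable on a nontrivial interval containing `0`; only the
principal value remains, where the `log ε` terms cancel. -/
theorem hasPVIntegral_neg_div_V_zero (hD : D ≠ 0) (hy₁ : y₁ ≤ 0) (hy₀ : 0 ≤ y₀)
    (hne : ¬(y₁ = 0 ∧ y₀ = 0)) {v : ℝ}
    (h : HasPVIntegral (fun y => -y / V 0 T D (0, y)) y₁ y₀ v) :
    y₁ < 0 ∧ 0 < y₀ ∧ D * v = Real.log (-y₁) - Real.log y₀ := by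
  simp only [neg_div_V_zero hD] at h
  rcases h with ⟨h, -⟩ | ⟨h1, h0, -, h⟩
  · have h' : IntervalIntegrable (fun y : ℝ => y⁻¹) volume y₁ y₀ := by
      refine (h.const_mul (-D)).congr (fun y _ => ?_)
      field_simp
    rcases intervalIntegrable_inv_iff.1 h' with h2 | h2
    · exact absurd ⟨by linarith, by linarith⟩ hne
    · exact absurd (by rw [Set.uIcc_of_le (hy₁.trans hy₀)]; exact ⟨hy₁, hy₀⟩) h2
  · refine ⟨h1, h0, ?_⟩
    have hl : Tendsto (fun _ : ℝ => -D⁻¹ * (Real.log y₀ - Real.log (-y₁))) (𝓝[>] 0) (𝓝 v) := by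
      refine h.congr' ?_
      filter_upwards [self_mem_nhdsWithin] with ε hε
      have hε : 0 < ε := hε
      rw [intervalIntegral.integral_const_mul, intervalIntegral.integral_const_mul,
        integral_inv_of_neg h1 (neg_lt_zero.2 hε), integral_inv_of_pos hε h0,
        Real.log_div h0.ne' hε.ne', show -ε / y₁ = ε / -y₁ by rw [div_neg, neg_div],
        Real.log_div hε.ne' (neg_pos.2 h1).ne']
      ring
    rw [← tendsto_nhds_unique tendsto_const_nhds hl]
    field_simp
    ring

theorem isLeftHalfMapImage_zero (hω : 0 < ω) (hD : D = T ^ 2 / 4 + ω ^ 2)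
    (hw : √(4 * D - T ^ 2) = 2 * ω) (hy₁ : y₁ ≤ 0)
    (hy₀ : 0 ≤ y₀) (hF : IndexLikeEq 0 T D y₁ y₀ (Real.pi / (D * (2 * ω)) * T)) :
    IsLeftHalfMapImage 0 T D y₀ y₁ (Real.pi / ω) := by
  have hD0 : D ≠ 0 := by rw [hD]; positivity
  by_cases h0 : y₁ = 0 ∧ y₀ = 0
  · refine Or.inr ⟨h0.2, h0.1, extendsToOrigin_zero hω hD, ?_⟩
    rw [originFlightTime, if_pos (by simp [vectorField]), hw]
    field_simp
  · have hF := hF.resolve_right fun h => h0 h.2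
    obtain ⟨h1, h2, h3⟩ := hasPVIntegral_neg_div_V_zero hD0 hy₁ hy₀ h0 hF
    have h4 : Real.log (-y₁) = Real.pi * T / (2 * ω) + Real.log y₀ := by
      rw [← sub_eq_iff_eq_add, ← h3]; field_simp
    have h5 : y₁ = -(Real.exp (Real.pi * T / (2 * ω)) * y₀) := by
      have := congrArg Real.exp h4
      rw [Real.exp_log (neg_pos.2 h1), Real.exp_add, Real.exp_log h2] at this
      linarith
    rw [h5]
    exact Or.inl (returnsLeft_zero hω hD h2)

end Zero

/-! ### The case `a < 0` -/

section Negative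

variable {a T D ω y₀ y₁ : ℝ}

theorem returnsLeft_of_neg (hω : 0 < ω) (hD : D = T ^ 2 / 4 + ω ^ 2) (ha : a < 0) (hy₁ : y₁ ≤ 0)
    (hy₀ : 0 ≤ y₀) (hα : D * ∫ y in y₁..y₀, -y / V a T D (0, y) = Real.pi * T / ω) :
    ReturnsLeft a T D y₀ y₁ (2 * Real.pi / ω + ∫ y in y₁..y₀, a / V a T D (0, y)) := by
  have hV := V_section_pos hω.ne' hD ha.ne
  have hV' (b d : ℝ) : ∀ y ∈ Set.uIcc b d, V a T D (0, y) ≠ 0 := fun y _ => (hV y).ne'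
  have hpi : 0 < Real.pi / ω := div_pos Real.pi_pos hω
  have hpi2 : 2 * Real.pi / ω = 2 * (Real.pi / ω) := by ring
  have hω2 : ω * (2 * Real.pi / ω) = 2 * Real.pi := by field_simp
  have hB (b d : ℝ) := abs_lt.1 (abs_integral_const_div_V_lt hω hD ha.ne b d)
  have hBpos {b d : ℝ} (hbd : b < d) : ∫ y in b..d, a / V a T D (0, y) < 0 := by
    have := intervalIntegral.intervalIntegral_pos_of_pos_on
      (intervalIntegrable_const_div_V (hV' b d)).neg
      (fun y _ => neg_pos.2 (div_neg_of_neg_of_pos ha (hV y))) hbd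
    simpa only [Pi.neg_apply, intervalIntegral.integral_neg, neg_pos] using this
  have hBsplit (b d e : ℝ) := intervalIntegral.integral_add_adjacent_intervals
    (intervalIntegrable_const_div_V (hV' b d)) (intervalIntegrable_const_div_V (hV' d e))
  have hAsplit (b d e : ℝ) := intervalIntegral.integral_add_adjacent_intervals
    (intervalIntegrable_neg_div_V (hV' b d)) (intervalIntegrable_neg_div_V (hV' d e))
  obtain ⟨Ψ, h⟩ := exists_isOrbitFrom a T D y₀
  have h0 : 0 < y₀ ∨ y₀ = 0 ∧ a < 0 := (lt_or_eq_of_le hy₀).imp id fun h => ⟨h.symm, ha⟩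
  have hu0 := sub_eigenvalue_mul_ne_zero (T := T) (y₀ := y₀) hω.ne' (Or.inl ha.ne)
  refine h.returnsLeft h0 (by linarith [(hB y₁ y₀).1]) (h.eq_of_exp_eq hω.ne' hD ?_)
    fun t ht ht0 => ?_
  · rw [← exp_mul_complex_flow_eq hD (hV' y₁ y₀) rfl rfl, ← Complex.ofReal_mul, hα]
    congr 1
    -- A full turn contributes `μ · 2π/ω = π T / ω + 2π i`, whose real part is `D A`.
    rw [show eigenvalue T ω * ((2 * Real.pi / ω + ∫ y in y₁..y₀, a / V a T D (0, y) : ℝ) : ℂ) =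
      (((Real.pi * T / ω : ℝ) : ℂ) + eigenvalue T ω * (∫ y in y₁..y₀, a / V a T D (0, y) : ℝ))
        + 2 * Real.pi * Complex.I from ?_, Complex.exp_periodic]
    rw [Complex.ofReal_add, mul_add, eigenvalue_mul_ofReal _ _ (2 * Real.pi / ω), hω2,
      show T / 2 * (2 * Real.pi / ω) = Real.pi * T / ω by ring]
    push_cast; ring
  · have h1 := h.exp_eq_of_fst_eq_zero hD ht0
    set m := (Ψ t).2
    rw [← exp_mul_complex_flow_eq hD (hV' m y₀) rfl rfl] at h1
    have h2 := mul_right_cancel₀ hu0 h1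
    set A := ∫ y in m..y₀, -y / V a T D (0, y)
    set B := ∫ y in m..y₀, a / V a T D (0, y) with hBm
    obtain ⟨n, hn, hn'⟩ := exp_real_add_eigenvalue_mul_eq_one (T := T) (ω := ω) (t := t - B)
      (b := -(D * A)) (by
        rw [show eigenvalue T ω * ((t - B : ℝ) : ℂ) + ((-(D * A) : ℝ) : ℂ) =
          eigenvalue T ω * t - (D * A + eigenvalue T ω * B) by push_cast; ring,
          Complex.exp_sub, h2, div_self (Complex.exp_ne_zero _)])
    have hB1 : ∫ y in y₁..y₀, a / V a T D (0, y) ≤ 0 := by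
      rcases eq_or_lt_of_le (hy₁.trans hy₀) with h | h
      · rw [h, intervalIntegral.integral_same]
      · exact (hBpos h).le
    have ht1 := ht.1
    have ht2 := ht.2
    have hBm1 := (hB m y₀).1
    have hBm2 := (hB m y₀).2
    rw [← hBm] at hBm1 hBm2
    have hD0 : 0 < D := by rw [hD]; positivity
    have htn : t - B = n * (2 * (Real.pi / ω)) := by
      field_simp; linarith
    -- From `|B| < π/ω` and `0 < t < 2π/ω`, the difference `t - B` lies strictly between `-π/ω` and
    -- `3π/ω`.
    have hn0 : n = 0 ∨ n = 1 := by
      have h3 : (-1 : ℝ) < n := by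
        by_contra hc
        nlinarith [not_lt.1 hc]
      have h4 : (n : ℝ) < 2 := by
        by_contra hc
        nlinarith [not_lt.1 hc]
      have h3 : -1 < n := by exact_mod_cast h3
      have h4 : n < 2 := by exact_mod_cast h4
      omega
    rcases hn0 with rfl | rfl
    -- No full turn: `B = t > 0` with `a < 0` forces `m > y₀ ≥ 0`, where `-y / V` is negative,
    -- against `A = 0`.
    · have hBt : B = t := by push_cast at htn; linarith
      have hA0 : A = 0 := by
        rw [hBt, sub_self, mul_zero, zero_add, neg_eq_zero] at hn'
        exact (mul_eq_zero.1 hn').resolve_left hD0.ne'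
      have hlt : y₀ < m := by
        by_contra hc
        rcases eq_or_lt_of_le (not_lt.1 hc) with h | h
        · rw [hBm, h, intervalIntegral.integral_same] at hBt; linarith
        · linarith [hBpos h]
      have := intervalIntegral.intervalIntegral_pos_of_pos_on
        (intervalIntegrable_neg_div_V (hV' y₀ m)).neg (fun y hy => by
          rw [Pi.neg_apply, ← neg_div, neg_neg]
          exact div_pos (hy₀.trans_lt hy.1) (hV y)) hlt
      simp only [Pi.neg_apply, intervalIntegral.integral_neg] at this
      rw [← intervalIntegral.integral_symm] at this
      linarith
    -- One full turn: `A` is the same as for `y₁`, while `t < τ` forces `m < y₁ ≤ 0`, where `-y / V`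
    -- is positive.
    · have hBt : t - B = 2 * (Real.pi / ω) := by rw [htn]; push_cast; ring
      have hA1 : D * A = Real.pi * T / ω := by
        rw [hBt] at hn'
        have : T / 2 * (2 * (Real.pi / ω)) = Real.pi * T / ω := by ring
        linarith
      have hA2 : A = ∫ y in y₁..y₀, -y / V a T D (0, y) :=
        mul_left_cancel₀ hD0.ne' (hA1.trans hα.symm)
      have hs := hBsplit m y₁ y₀
      have hs' := hAsplit m y₁ y₀
      have hlt : m < y₁ := by
        by_contra hc
        rcases eq_or_lt_of_le (not_lt.1 hc) with h | h
        · rw [h] at ht2; linarith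
        · have := hBpos h
          rw [intervalIntegral.integral_symm] at this
          linarith
      have := intervalIntegral.intervalIntegral_pos_of_pos_on
        (intervalIntegrable_neg_div_V (hV' m y₁))
        (fun y hy => div_pos (neg_pos.2 (hy.2.trans_le hy₁)) (hV y)) hlt
      linarith

end Negative

end PoincareHalfMap

/-! ### The theorem: assembly of the three cases -/

open PoincareHalfMap in
theorem mainTheorem2 (a T D : ℝ) (haD : a ^ 2 + D ^ 2 ≠ 0)
    (hI : (PoincareHalfMap.mainInterval a T D).Nonempty)
    (c y₀ y₁ : ℝ)
    (hy₀I : y₀ ∈ PoincareHalfMap.mainInterval a T D)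
    (hy₁I : y₁ ∈ PoincareHalfMap.mainInterval a T D)
    (hy₀ : 0 ≤ y₀) (hy₁ : y₁ ≤ 0)
    (hF : PoincareHalfMap.IndexLikeEq a T D y₁ y₀ (c * T))
    (hc : (c = 0 ∧ 0 < a) ∨
      (0 < 4 * D - T ^ 2 ∧ c = Real.pi / (D * Real.sqrt (4 * D - T ^ 2)) ∧ a = 0) ∨
      (0 < 4 * D - T ^ 2 ∧ c = 2 * Real.pi / (D * Real.sqrt (4 * D - T ^ 2)) ∧ a < 0)) :
    IntervalIntegrable (fun y => a / PoincareHalfMap.V a T D (0, y)) volume y₁ y₀ ∧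
    PoincareHalfMap.IsLeftHalfMapImage a T D y₀ y₁
      (2 * D * c + ∫ y in y₁..y₀, a / PoincareHalfMap.V a T D (0, y)) := by
  rcases hc with ⟨rfl, ha⟩ | ⟨hd, rfl, rfl⟩ | ⟨hd, rfl, ha⟩
  · have hV := fun y (hy : y ∈ Set.Icc y₁ y₀) => V_pos_of_mem_mainInterval ha hy₁I hy₀I hy
    have hV' : ∀ y ∈ Set.uIcc y₁ y₀, V a T D (0, y) ≠ 0 := fun y hy =>
      (hV y (by rwa [Set.uIcc_of_le (hy₁.trans hy₀)] at hy)).ne'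
    refine ⟨intervalIntegrable_const_div_V hV', ?_⟩
    have hα := (hF.resolve_right fun h => ha.ne' h.1).integral_eq (intervalIntegrable_neg_div_V hV')
    rw [zero_mul] at hα
    rw [mul_zero, zero_add]
    -- On an interval with one endpoint at `0` the integrand has a strict sign, so a zero integral
    -- makes the interval trivial.
    have hiff : y₁ = 0 ↔ y₀ = 0 := by
      constructor
      · rintro rfl
        by_contra hne
        have := intervalIntegral.intervalIntegral_pos_of_pos_on
          (intervalIntegrable_neg_div_V hV').neg (fun y hy => by
            rw [Pi.neg_apply, ← neg_div, neg_neg]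
            exact div_pos hy.1 (hV y (Set.Ioo_subset_Icc_self hy)))
          (lt_of_le_of_ne hy₀ (Ne.symm hne))
        simp only [Pi.neg_apply, intervalIntegral.integral_neg] at this
        linarith
      · rintro rfl
        by_contra hne
        have := intervalIntegral.intervalIntegral_pos_of_pos_on (intervalIntegrable_neg_div_V hV')
          (fun y hy => div_pos (neg_pos.2 hy.2) (hV y (Set.Ioo_subset_Icc_self hy)))
          (lt_of_le_of_ne hy₁ hne)
        linarith
    by_cases h0 : y₀ = 0
    · obtain rfl := hiff.2 h0
      subst h0
      refine Or.inr ⟨rfl, rfl, extendsToOrigin_of_pos ha, ?_⟩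
      rw [intervalIntegral.integral_same, originFlightTime, if_neg]
      simp [vectorField, ha.ne']
    · exact Or.inl (returnsLeft_of_integral_eq_zero ha
        (lt_of_le_of_ne hy₁ fun h => h0 (hiff.1 h)) (lt_of_le_of_ne hy₀ (Ne.symm h0)) hV hα)
  · obtain ⟨ω, hω, hD, hw⟩ := exists_angular_frequency hd
    have hD0 : D ≠ 0 := by rw [hD]; positivity
    rw [hw] at hF ⊢
    refine ⟨by simp, ?_⟩
    convert isLeftHalfMapImage_zero hω hD hw hy₁ hy₀ hF using 1
    simp only [zero_div, intervalIntegral.integral_zero, add_zero]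
    field_simp
  · obtain ⟨ω, hω, hD, hw⟩ := exists_angular_frequency hd
    have hD0 : D ≠ 0 := by rw [hD]; positivity
    have hV' : ∀ y ∈ Set.uIcc y₁ y₀, V a T D (0, y) ≠ 0 := fun y _ =>
      (V_section_pos hω.ne' hD ha.ne y).ne'
    rw [hw] at hF ⊢
    refine ⟨intervalIntegrable_const_div_V hV', Or.inl ?_⟩
    have hα := (hF.resolve_right fun h => ha.ne h.1).integral_eq (intervalIntegrable_neg_div_V hV')
    convert returnsLeft_of_neg hω hD ha hy₁ hy₀ (by rw [hα]; field_simp) using 2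
    field_simp
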